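/- Let $\{\mathbf x_k\}_{k\in\mathbb Z}$ and $\{\mathbf y_k\}_{k\in\mathbb Z}$ be discrete-time stochastic processes with values in $\mathbb R^m$ and finite second moments, with laws $p_{\{\mathbf x_k\}}$ and $p_{\{\mathbf y_k\}}$; they need not be elliptical. Assume that both are stationary, i.e. $\mathbb E[\mathbf x_i\mathbf x_{i+k}^{\mathrm T}]=R_{\mathbf x}(k)$ depends only on $k$, and likewise for $\mathbf y$, and that the power spectra $$\Phi_{\mathbf x}(\omega)=\sum_{k=-\infty}^{\infty}R_{\mathbf x}(k)\,e^{-\mathrm j\omega k},\qquad \Phi_{\mathbf y}(\omega)=\sum_{k=-\infty}^{\infty}R_{\mathbf y}(k)\,e^{-\mathrm j\omega k}$$ exist for every $\omega\in\mathbb R$, as limits of the symmetric partial sums $\sum_{k=-N}^{N}$ for $N\to\infty$. (They are then automatically Hermitian positive semidefinite.) Define the average $\mathcal W_2$ distance by $$\mathcal W_2\left(p_{\{\mathbf x_k\}};p_{\{\mathbf y_k\}}\right)=\left(\inf\ \limsup_{i\to\infty}\frac{\mathbb E\left[\sum_{k=0}^{i}\|\mathbf x_k-\mathbf y_k\|^2\right]}{i+1}\right)^{1/2},$$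 where the infimum is over all couplings, i.e. all joint laws of $(\{\mathbf x_k\},\{\mathbf y_k\})$ with marginals $p_{\{\mathbf x_k\}}$ and $p_{\{\mathbf y_k\}}$, and $\|\cdot\|$ is the Euclidean norm. Put $$W[\Phi_{\mathbf x}(\omega),\Phi_{\mathbf y}(\omega)]=\Phi_{\mathbf x}(\omega)+\Phi_{\mathbf y}(\omega)-2\left[\Phi_{\mathbf x}^{1/2}(\omega)\,\Phi_{\mathbf y}(\omega)\,\Phi_{\mathbf x}^{1/2}(\omega)\right]^{1/2},$$ with positive semidefinite square roots. Then $\omega\mapsto\operatorname{tr}W[\Phi_{\mathbf x}(\omega),\Phi_{\mathbf y}(\omega)]$ is integrable on $[0,2\pi]$ and $$\mathcal W_2\left(p_{\{\mathbf x_k\}};p_{\{\mathbf y_k\}}\right)\ \ge\ \sqrt{\frac1{2\pi}\int_0^{2\pi}\operatorname{tr}W[\Phi_{\mathbf x}(\omega),\Phi_{\mathbf y}(\omega)]\,\mathrm d\omega}.$$ -/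

import Mathlib

open MeasureTheory Filter Topology
open scoped ENNReal MatrixOrder

noncomputable section

namespace SpectralW2

/-- Euclidean `m`-space, the state space of an `m`-dimensional process. -/
abbrev E (m : ℕ) : Type := EuclideanSpace ℝ (Fin m)

/-- The law of a process `{x_k}`, a measure on the space of two-sided sequences. -/
def law {m : ℕ} {Ω : Type*} [MeasurableSpace Ω] (P : Measure Ω) (x : ℤ → Ω → E m) :
    Measure (ℤ → E m) :=
  P.map (fun s k => x k s)

/-- The auto-correlation `R(i, k) = 𝔼[x_i x_{i+k}ᵀ]`. -/
def autocorr {m : ℕ} {Ω : Type*} [MeasurableSpace Ω] (P : Measure Ω) (x : ℤ → Ω → E m)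
    (i k : ℤ) : Matrix (Fin m) (Fin m) ℝ :=
  Matrix.of fun a b => ∫ s, x i s a * x (i + k) s b ∂P

/-- A second-order process is stationary if `R(i, k)` depends only on the lag `k`. -/
structure IsStationary {m : ℕ} {Ω : Type*} [MeasurableSpace Ω] (P : Measure Ω)
    (x : ℤ → Ω → E m) : Prop where
  memLp_two : ∀ k, MemLp (x k) 2 P
  autocorr_eq : ∀ i j k, autocorr P x i k = autocorr P x j k

/-- `Φ` is the power spectrum of the stationary process `x`: for every frequency `ω`,
`Φ(ω) = ∑_{k = -∞}^{∞} R(k) e^{-jωk}`, as the limit of the symmetric partial sums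
(absolute convergence is not required). -/
def IsPowerSpectrum {m : ℕ} {Ω : Type*} [MeasurableSpace Ω] (P : Measure Ω)
    (x : ℤ → Ω → E m) (Φ : ℝ → Matrix (Fin m) (Fin m) ℂ) : Prop :=
  ∀ ω : ℝ, Tendsto
    (fun N : ℕ => ∑ k ∈ Finset.Icc (-(N : ℤ)) (N : ℤ),
      Complex.exp (-(Complex.I * (ω : ℂ) * (k : ℂ))) • (autocorr P x 0 k).map Complex.ofReal)
    atTop (𝓝 (Φ ω))

/-- The couplings of two measures: joint laws with the prescribed marginals. -/
def couplings {α β : Type*} [MeasurableSpace α] [MeasurableSpace β]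
    (μ : Measure α) (ν : Measure β) : Set (Measure (α × β)) :=
  {γ | γ.map Prod.fst = μ ∧ γ.map Prod.snd = ν}

/-- The stacked vector `u_{0,…,i} = [u_0ᵀ, …, u_iᵀ]ᵀ`, with its Euclidean norm. -/
def stack {m : ℕ} (u : ℤ → E m) (i : ℕ) : PiLp 2 (fun _ : Fin (i + 1) => E m) :=
  WithLp.toLp 2 fun k => u (k : ℕ)

/-- The average Wasserstein distance of order `p` between two laws of processes,
`(inf limsup_{i → ∞} 𝔼 ‖x_{0,…,i} - y_{0,…,i}‖ ^ p / (i + 1)) ^ (1 / p)`,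
the infimum being over all couplings of the two laws. -/
def avgWasserstein {m : ℕ} (p : ℝ) (μ ν : Measure (ℤ → E m)) : ℝ≥0∞ :=
  (⨅ γ ∈ couplings μ ν,
    limsup (fun i : ℕ => (∫⁻ z, ‖stack z.1 i - stack z.2 i‖ₑ ^ p ∂γ) / ((i : ℝ≥0∞) + 1))
      atTop) ^ (1 / p)

/-- `W[A, B] = A + B - 2 (A^{1/2} B A^{1/2})^{1/2}`, with the positive semidefinite square root
of a positive semidefinite Hermitian matrix. -/
def gelbrich {m : ℕ} (A B : Matrix (Fin m) (Fin m) ℂ) : Matrix (Fin m) (Fin m) ℂ :=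
  A + B - (2 : ℂ) • CFC.sqrt (CFC.sqrt A * B * CFC.sqrt A)

end SpectralW2

end

/-! Fix a coupling and pass to the normalized finite Fourier transforms of both processes over `n`
time steps. Their second moment matrices depend only on the marginals. By stationarity they are
Cesàro means of the symmetric partial sums of the spectra (`crossMoment_fourierSum_eq_fejerMean`),
hence positive semidefinite and convergent to `Φ ω` at every frequency, without any absolute
summability.

At each frequency Gelbrich's inequality (`re_trace_gelbrich_crossMoment_le`) bounds the mean squared
distance of the two transforms below by `tr W` of these matrices. Integrated over a period,
Parseval's identity turns that distance into `2π` times the time-averaged cost; this needs no joint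
stationarity of the coupling. Since `tr W` is continuous and nonnegative on positive semidefinite
matrices, Fatou's lemma carries the bound to the spectra, with a liminf, hence a limsup, of the
costs on the right. The infimum over couplings follows. Integrability comes from the same bound for
the product coupling, whose average cost is bounded.

Gelbrich's inequality rests on a duality: Young's inequality gives `2 Re tr 𝔼[XYᴴ] ≤ tr (S A) + tr
(S⁻¹ B)`, with real parts on the right, for every positive definite `S`, and the Gaussian transport
map makes both traces equal to `tr (A^{1/2} B A^{1/2})^{1/2}`. Singular matrices are reached by
adding `ε • 1`. -/

open scoped ComplexOrder Matrix

namespace SpectralW2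

/-! ### Continuity, positivity and dual bound for the Gelbrich functional. -/

section Gelbrich

variable {m : ℕ}

open scoped Matrix.Norms.L2Operator in
/-- The positive semidefinite square root is continuous on positive semidefinite matrices. -/
theorem continuousOn_sqrt :
    ContinuousOn (CFC.sqrt : Matrix (Fin m) (Fin m) ℂ → Matrix (Fin m) (Fin m) ℂ) {A | 0 ≤ A} := by
  unfold CFC.sqrt
  exact ContinuousOn.cfcₙ_nnreal_of_mem_nhdsSet (s := Set.univ) NNReal.sqrt univ_mem
    continuousOn_id (fun _ h => h) NNReal.continuous_sqrt.continuousOn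

/-- The matrix under the outer square root in the Gelbrich formula is positive semidefinite. -/
theorem sqrt_mul_mul_sqrt_nonneg (A : Matrix (Fin m) (Fin m) ℂ) {B : Matrix (Fin m) (Fin m) ℂ}
    (hB : 0 ≤ B) : 0 ≤ CFC.sqrt A * B * CFC.sqrt A :=
  (CFC.sqrt_nonneg A).isSelfAdjoint.conjugate_nonneg hB

theorem continuousOn_gelbrich :
    ContinuousOn (fun p : Matrix (Fin m) (Fin m) ℂ × Matrix (Fin m) (Fin m) ℂ =>
      gelbrich p.1 p.2) ({A | 0 ≤ A} ×ˢ {B | 0 ≤ B}) := by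
  have hs : ContinuousOn (fun p : Matrix (Fin m) (Fin m) ℂ × Matrix (Fin m) (Fin m) ℂ =>
      CFC.sqrt p.1) ({A | 0 ≤ A} ×ˢ {B | 0 ≤ B}) :=
    continuousOn_sqrt.comp continuousOn_fst fun p hp => hp.1
  have hM : ContinuousOn (fun p : Matrix (Fin m) (Fin m) ℂ × Matrix (Fin m) (Fin m) ℂ =>
      CFC.sqrt (CFC.sqrt p.1 * p.2 * CFC.sqrt p.1)) ({A | 0 ≤ A} ×ˢ {B | 0 ≤ B}) :=
    continuousOn_sqrt.comp ((hs.mul continuousOn_snd).mul hs)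
      fun p hp => sqrt_mul_mul_sqrt_nonneg _ hp.2
  exact (continuousOn_fst.add continuousOn_snd).sub (hM.const_smul (2 : ℂ))

theorem continuousOn_re_trace_gelbrich :
    ContinuousOn (fun p : Matrix (Fin m) (Fin m) ℂ × Matrix (Fin m) (Fin m) ℂ =>
      (gelbrich p.1 p.2).trace.re) ({A | 0 ≤ A} ×ˢ {B | 0 ≤ B}) :=
  (Complex.continuous_re.comp (continuous_id.matrix_trace)).comp_continuousOn continuousOn_gelbrich

/-- Serves three limits: the regularization `ε → 0`, continuity in the frequency, and convergence of
the Fejér means. -/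
theorem tendsto_re_trace_gelbrich {ι : Type*} {l : Filter ι}
    {A B : ι → Matrix (Fin m) (Fin m) ℂ} {A₀ B₀ : Matrix (Fin m) (Fin m) ℂ}
    (hA : ∀ i, 0 ≤ A i) (hB : ∀ i, 0 ≤ B i) (hA₀ : 0 ≤ A₀) (hB₀ : 0 ≤ B₀)
    (hAl : Tendsto A l (𝓝 A₀)) (hBl : Tendsto B l (𝓝 B₀)) :
    Tendsto (fun i => (gelbrich (A i) (B i)).trace.re) l (𝓝 (gelbrich A₀ B₀).trace.re) := by
  have h := (continuousOn_re_trace_gelbrich (m := m)).continuousWithinAt (x := (A₀, B₀)) ⟨hA₀, hB₀⟩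
  have hm : ∀ i, (A i, B i) ∈ ({A | 0 ≤ A} ×ˢ {B | 0 ≤ B} :
      Set (Matrix (Fin m) (Fin m) ℂ × Matrix (Fin m) (Fin m) ℂ)) := fun i => ⟨hA i, hB i⟩
  have hl : Tendsto (fun i => (A i, B i)) l (𝓝[{A | 0 ≤ A} ×ˢ {B | 0 ≤ B}] (A₀, B₀)) :=
    tendsto_nhdsWithin_iff.2 ⟨hAl.prodMk_nhds hBl, Eventually.of_forall hm⟩
  have hc := Tendsto.comp (ContinuousWithinAt.tendsto h) hl
  exact hc

/-- The optimal transport map between two nondegenerate centred Gaussians. -/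
theorem exists_posDef_transport {A B : Matrix (Fin m) (Fin m) ℂ} (hA : A.PosDef) (hB : B.PosDef) :
    ∃ S : Matrix (Fin m) (Fin m) ℂ, S.PosDef ∧ S * A * S = B ∧
      (S * A).trace = (CFC.sqrt (CFC.sqrt A * B * CFC.sqrt A)).trace ∧
      (S⁻¹ * B).trace = (CFC.sqrt (CFC.sqrt A * B * CFC.sqrt A)).trace := by
  have hA0 : 0 ≤ A := hA.posSemidef.nonneg
  have hB0 : 0 ≤ B := hB.posSemidef.nonneg
  set P := CFC.sqrt A with hP
  have hPP : P * P = A := CFC.sqrt_mul_sqrt_self A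
  have hPu : IsUnit P := (CFC.isUnit_sqrt_iff A).2 hA.isUnit
  have hPd : P.det ≠ 0 := ((Matrix.isUnit_iff_isUnit_det P).1 hPu).ne_zero
  have hM0 : 0 ≤ P * B * P := sqrt_mul_mul_sqrt_nonneg A hB0
  set Q := CFC.sqrt (P * B * P) with hQ
  have hQQ : Q * Q = P * B * P := CFC.sqrt_mul_sqrt_self _
  have hQu : IsUnit Q := (CFC.isUnit_sqrt_iff _).2 ((hPu.mul hB.isUnit).mul hPu)
  have hQd : Q.det ≠ 0 := ((Matrix.isUnit_iff_isUnit_det Q).1 hQu).ne_zero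
  have hPi : P * P⁻¹ = 1 := Matrix.mul_nonsing_inv _ hPd.isUnit
  have hiP : P⁻¹ * P = 1 := Matrix.nonsing_inv_mul _ hPd.isUnit
  have hiQ : Q⁻¹ * Q = 1 := Matrix.nonsing_inv_mul _ hQd.isUnit
  have hPh : P.IsHermitian := (Matrix.nonneg_iff_posSemidef.1 (CFC.sqrt_nonneg A)).isHermitian
  have hPih : (P⁻¹)ᴴ = P⁻¹ := by rw [Matrix.conjTranspose_nonsing_inv, hPh.eq]
  have hQpd : Q.PosDef :=
    (Matrix.nonneg_iff_posSemidef.1 (CFC.sqrt_nonneg (P * B * P))).posDef_iff_isUnit.2 hQu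
  -- The Gaussian transport map `A^{-1/2} (A^{1/2} B A^{1/2})^{1/2} A^{-1/2}`.
  refine ⟨P⁻¹ * Q * P⁻¹, ?_, ?_, ?_, ?_⟩
  · have h := Matrix.IsUnit.posDef_star_left_conjugate_iff (U := P⁻¹) (x := Q)
      ((Matrix.isUnit_nonsing_inv_iff).2 hPu)
    rw [Matrix.star_eq_conjTranspose, hPih] at h
    exact h.2 hQpd
  · calc P⁻¹ * Q * P⁻¹ * A * (P⁻¹ * Q * P⁻¹)
        = P⁻¹ * Q * (P⁻¹ * P) * (P * P⁻¹) * Q * P⁻¹ := by rw [← hPP]; noncomm_ring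
      _ = P⁻¹ * (Q * Q) * P⁻¹ := by rw [hiP, hPi]; noncomm_ring
      _ = (P⁻¹ * P) * B * (P * P⁻¹) := by rw [hQQ]; noncomm_ring
      _ = B := by rw [hiP, hPi]; simp
  · calc (P⁻¹ * Q * P⁻¹ * A).trace = (P⁻¹ * (Q * (P⁻¹ * P) * P)).trace := by
          rw [← hPP]; congr 1; noncomm_ring
      _ = (Q * (P * P⁻¹)).trace := by rw [Matrix.trace_mul_comm, hiP]; congr 1; noncomm_ring
      _ = Q.trace := by rw [hPi, mul_one]
  · have hinv : (P⁻¹ * Q * P⁻¹)⁻¹ = P * Q⁻¹ * P := by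
      rw [Matrix.mul_inv_rev, Matrix.mul_inv_rev, Matrix.nonsing_inv_nonsing_inv _ hPd.isUnit,
        mul_assoc]
    calc ((P⁻¹ * Q * P⁻¹)⁻¹ * B).trace = (P * (Q⁻¹ * P * B)).trace := by
          rw [hinv]; congr 1; noncomm_ring
      _ = (Q⁻¹ * (P * B * P)).trace := by rw [Matrix.trace_mul_comm]; congr 1; noncomm_ring
      _ = Q.trace := by rw [← hQQ, ← mul_assoc, hiQ, one_mul]

theorem posDef_add_smul_one {A : Matrix (Fin m) (Fin m) ℂ} (hA : 0 ≤ A) {ε : ℝ} (hε : 0 < ε) :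
    (A + (ε : ℂ) • (1 : Matrix (Fin m) (Fin m) ℂ)).PosDef :=
  Matrix.PosDef.posSemidef_add (Matrix.nonneg_iff_posSemidef.1 hA)
    (Matrix.PosDef.one.smul (by exact_mod_cast hε))

theorem tendsto_add_smul_one (A : Matrix (Fin m) (Fin m) ℂ) :
    Tendsto (fun n : ℕ => A + ((1 / ((n : ℝ) + 1) : ℝ) : ℂ) • (1 : Matrix (Fin m) (Fin m) ℂ)) atTop
      (𝓝 A) := by
  have h : Tendsto (fun n : ℕ => ((1 / ((n : ℝ) + 1) : ℝ) : ℂ)) atTop (𝓝 ((0 : ℝ) : ℂ)) :=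
    (Complex.continuous_ofReal.tendsto 0).comp tendsto_one_div_add_atTop_nhds_zero_nat
  simpa using tendsto_const_nhds.add (h.smul_const (1 : Matrix (Fin m) (Fin m) ℂ))

theorem tendsto_re_trace_gelbrich_add_smul_one {A B : Matrix (Fin m) (Fin m) ℂ}
    (hA : 0 ≤ A) (hB : 0 ≤ B) :
    Tendsto (fun n : ℕ => (gelbrich
        (A + ((1 / ((n : ℝ) + 1) : ℝ) : ℂ) • (1 : Matrix (Fin m) (Fin m) ℂ))
        (B + ((1 / ((n : ℝ) + 1) : ℝ) : ℂ) • (1 : Matrix (Fin m) (Fin m) ℂ))).trace.re) atTop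
      (𝓝 (gelbrich A B).trace.re) :=
  tendsto_re_trace_gelbrich
    (fun _ => (posDef_add_smul_one hA Nat.one_div_pos_of_nat).posSemidef.nonneg)
    (fun _ => (posDef_add_smul_one hB Nat.one_div_pos_of_nat).posSemidef.nonneg)
    hA hB (tendsto_add_smul_one A) (tendsto_add_smul_one B)

theorem re_trace_gelbrich (A B : Matrix (Fin m) (Fin m) ℂ) :
    (gelbrich A B).trace.re = A.trace.re + B.trace.re -
      2 * (CFC.sqrt (CFC.sqrt A * B * CFC.sqrt A)).trace.re := by
  simp [gelbrich, Matrix.trace_add, Matrix.trace_sub, Matrix.trace_smul]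

/-- With `S` the transport map, the trace is that of `(1 - S) A (1 - S)ᴴ`, the cost of moving each
point `v` to `S v`. -/
theorem re_trace_gelbrich_nonneg_of_posDef {A B : Matrix (Fin m) (Fin m) ℂ}
    (hA : A.PosDef) (hB : B.PosDef) : 0 ≤ (gelbrich A B).trace.re := by
  obtain ⟨S, hS, hSAS, h1, -⟩ := exists_posDef_transport hA hB
  have h := (hA.posSemidef.mul_mul_conjTranspose_same (1 - S)).trace_nonneg
  have e : ((1 - S) * A * (1 - S)ᴴ).trace = A.trace + B.trace - 2 * (S * A).trace := by
    have : (1 - S) * A * (1 - S)ᴴ = A - S * A - A * S + S * A * S := by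
      rw [Matrix.conjTranspose_sub, Matrix.conjTranspose_one, hS.isHermitian.eq]; noncomm_ring
    rw [this, Matrix.trace_add, Matrix.trace_sub, Matrix.trace_sub, hSAS, Matrix.trace_mul_comm A S]
    ring
  rw [e, h1] at h
  have h' := (Complex.le_def.1 h).1
  rw [re_trace_gelbrich]
  simpa using h'

/-- The squared Gelbrich distance is nonnegative. -/
theorem re_trace_gelbrich_nonneg {A B : Matrix (Fin m) (Fin m) ℂ} (hA : 0 ≤ A) (hB : 0 ≤ B) :
    0 ≤ (gelbrich A B).trace.re :=
  ge_of_tendsto' (tendsto_re_trace_gelbrich_add_smul_one hA hB) fun _ =>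
    re_trace_gelbrich_nonneg_of_posDef (posDef_add_smul_one hA Nat.one_div_pos_of_nat)
      (posDef_add_smul_one hB Nat.one_div_pos_of_nat)

/-- Any bound of `2 c` by the transport cost functionals `S ↦ tr (S A) + tr (S⁻¹ B)` is inherited
by the square root term of the Gelbrich formula. -/
theorem re_trace_gelbrich_le {A B : Matrix (Fin m) (Fin m) ℂ} (hA : 0 ≤ A) (hB : 0 ≤ B) {c : ℝ}
    (hc : ∀ S : Matrix (Fin m) (Fin m) ℂ, S.PosDef →
      2 * c ≤ (S * A).trace.re + (S⁻¹ * B).trace.re) :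
    (gelbrich A B).trace.re ≤ A.trace.re + B.trace.re - 2 * c := by
  have hlim := (((continuous_id.matrix_trace (n := Fin m) (R := ℂ)).tendsto A).comp
    (tendsto_add_smul_one A)).add
    (((continuous_id.matrix_trace (n := Fin m) (R := ℂ)).tendsto B).comp (tendsto_add_smul_one B))
  have hlim' := ((Complex.continuous_re.tendsto _).comp hlim).sub_const (2 * c)
  refine (le_of_tendsto_of_tendsto' (tendsto_re_trace_gelbrich_add_smul_one hA hB) hlim'
    fun n => ?_).trans_eq (by simp)
  set ε : ℝ := 1 / ((n : ℝ) + 1)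
  have hε : 0 < ε := Nat.one_div_pos_of_nat
  obtain ⟨S, hS, -, h1, h2⟩ := exists_posDef_transport (posDef_add_smul_one hA hε)
    (posDef_add_smul_one hB hε)
  -- `S` is optimal for the regularized pair while `hc` concerns `A` and `B` themselves. Adding `ε •
  -- 1` only increases the traces, as `tr T ≥ 0`.
  have hmono : ∀ {T C : Matrix (Fin m) (Fin m) ℂ}, T.PosDef →
      (T * C).trace.re ≤ (T * (C + (ε : ℂ) • (1 : Matrix (Fin m) (Fin m) ℂ))).trace.re := by
    intro T C hT
    have h := (Complex.le_def.1 hT.posSemidef.trace_nonneg).1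
    simp only [mul_add, Matrix.trace_add, Matrix.mul_smul, mul_one, Matrix.trace_smul, smul_eq_mul,
      Complex.add_re, Complex.re_ofReal_mul]
    simp only [Complex.zero_re] at h
    nlinarith
  have h3 := hc S hS
  have h4 := hmono (C := A) hS
  have h5 := hmono (C := B) hS.inv
  rw [h1] at h4
  rw [h2] at h5
  rw [re_trace_gelbrich]
  simp only [Function.comp_apply, id_eq, Complex.add_re]
  linarith

end Gelbrich

/-! ### Second moments of complex random vectors and Gelbrich's inequality. -/

section Moments

variable {m : ℕ} {Z : Type*} [MeasurableSpace Z] {γ : Measure Z}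

/-- The cross second moment `𝔼[X Yᴴ]` of two complex random vectors. -/
noncomputable def crossMoment (γ : Measure Z) (X Y : Z → Fin m → ℂ) : Matrix (Fin m) (Fin m) ℂ :=
  Matrix.of fun a b => ∫ z, X z a * star (Y z b) ∂γ

/-- A complex random vector all of whose coordinates are square integrable. -/
def CoordMemLp (γ : Measure Z) (X : Z → Fin m → ℂ) : Prop :=
  ∀ a, MemLp (fun z => X z a) 2 γ

namespace CoordMemLp

variable {X Y : Z → Fin m → ℂ}

theorem integrable_mul_star (hX : CoordMemLp γ X) (hY : CoordMemLp γ Y) (a b : Fin m) :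
    Integrable (fun z => X z a * star (Y z b)) γ :=
  MemLp.integrable_mul (hX a) (hY b).star

theorem sub (hX : CoordMemLp γ X) (hY : CoordMemLp γ Y) :
    CoordMemLp γ (fun z => X z - Y z) :=
  fun a => (hX a).sub (hY a)

theorem sum_smul {ι : Type*} (s : Finset ι) (w : ι → ℂ) {U : ι → Z → Fin m → ℂ}
    (hU : ∀ i, CoordMemLp γ (U i)) : CoordMemLp γ (fun z => ∑ i ∈ s, w i • U i z) := by
  intro a
  simpa [Finset.sum_apply] using memLp_finsetSum s fun i _ => ((hU i) a).const_mul (w i)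

end CoordMemLp

variable {X Y : Z → Fin m → ℂ}

theorem crossMoment_sum_smul {ι : Type*} (s : Finset ι) (w : ι → ℂ) {U : ι → Z → Fin m → ℂ}
    (hU : ∀ i, CoordMemLp γ (U i)) :
    crossMoment γ (fun z => ∑ i ∈ s, w i • U i z) (fun z => ∑ i ∈ s, w i • U i z) =
      ∑ i ∈ s, ∑ j ∈ s, (w i * star (w j)) • crossMoment γ (U i) (U j) := by
  ext a b
  have hp : ∀ z, (∑ i ∈ s, w i • U i z) a * star ((∑ i ∈ s, w i • U i z) b) =
      ∑ i ∈ s, ∑ j ∈ s, (w i * star (w j)) * (U i z a * star (U j z b)) := by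
    intro z
    simp only [Finset.sum_apply, Pi.smul_apply, smul_eq_mul, star_sum, star_mul',
      Finset.sum_mul_sum]
    refine Finset.sum_congr rfl fun i _ => Finset.sum_congr rfl fun j _ => by ring
  have hi : ∀ i j, Integrable (fun z => (w i * star (w j)) * (U i z a * star (U j z b))) γ :=
    fun i j => ((hU i).integrable_mul_star (hU j) a b).const_mul _
  simp only [crossMoment, Matrix.of_apply, hp, Matrix.sum_apply, Matrix.smul_apply, smul_eq_mul]
  rw [integral_finsetSum _ fun i _ => integrable_finsetSum _ fun j _ => hi i j]
  refine Finset.sum_congr rfl fun i _ => ?_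
  rw [integral_finsetSum _ fun j _ => hi i j]
  exact Finset.sum_congr rfl fun j _ => integral_const_mul _ _

/-- Reduces trace inequalities between moment matrices to pointwise inequalities between quadratic
forms, which are then integrated. -/
theorem trace_mul_crossMoment (S : Matrix (Fin m) (Fin m) ℂ) (hX : CoordMemLp γ X)
    (hY : CoordMemLp γ Y) :
    (S * crossMoment γ X Y).trace = ∫ z, (S * Matrix.vecMulVec (X z) (star (Y z))).trace ∂γ := by
  simp only [Matrix.trace, Matrix.diag, Matrix.mul_apply, crossMoment, Matrix.of_apply,
    Matrix.vecMulVec_apply, Pi.star_apply]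
  have hi : ∀ a b, Integrable (fun z => S a b * (X z b * star (Y z a))) γ :=
    fun a b => (hX.integrable_mul_star hY b a).const_mul _
  rw [integral_finsetSum _ fun a _ => integrable_finsetSum _ fun b _ => hi a b]
  refine Finset.sum_congr rfl fun a _ => ?_
  rw [integral_finsetSum _ fun b _ => hi a b]
  exact Finset.sum_congr rfl fun b _ => (integral_const_mul _ _).symm

theorem integrable_trace_mul_vecMulVec (S : Matrix (Fin m) (Fin m) ℂ) (hX : CoordMemLp γ X)
    (hY : CoordMemLp γ Y) :
    Integrable (fun z => (S * Matrix.vecMulVec (X z) (star (Y z))).trace) γ := by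
  simp only [Matrix.trace, Matrix.diag, Matrix.mul_apply, Matrix.vecMulVec_apply, Pi.star_apply]
  exact integrable_finsetSum _ fun a _ => integrable_finsetSum _ fun b _ =>
    (hX.integrable_mul_star hY b a).const_mul _

theorem integrable_re_trace_mul_vecMulVec (S : Matrix (Fin m) (Fin m) ℂ) (hX : CoordMemLp γ X)
    (hY : CoordMemLp γ Y) :
    Integrable (fun z => (S * Matrix.vecMulVec (X z) (star (Y z))).trace.re) γ :=
  (integrable_trace_mul_vecMulVec S hX hY).re

theorem re_trace_mul_crossMoment (S : Matrix (Fin m) (Fin m) ℂ) (hX : CoordMemLp γ X)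
    (hY : CoordMemLp γ Y) :
    (S * crossMoment γ X Y).trace.re =
      ∫ z, (S * Matrix.vecMulVec (X z) (star (Y z))).trace.re ∂γ := by
  rw [trace_mul_crossMoment S hX hY]
  exact (integral_re (integrable_trace_mul_vecMulVec S hX hY)).symm

theorem trace_mul_vecMulVec_star (S : Matrix (Fin m) (Fin m) ℂ) (v w : Fin m → ℂ) :
    (S * Matrix.vecMulVec v (star w)).trace = star w ⬝ᵥ S *ᵥ v := by
  rw [Matrix.mul_vecMulVec, Matrix.trace_vecMulVec, dotProduct_comm]

/-- The second moment matrix of a complex random vector is positive semidefinite. -/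
theorem crossMoment_self_nonneg (hX : CoordMemLp γ X) : 0 ≤ crossMoment γ X X := by
  refine Matrix.nonneg_iff_posSemidef.2 (Matrix.PosSemidef.of_dotProduct_mulVec_nonneg ?_ ?_)
  · ext a b
    simp only [Matrix.conjTranspose_apply, crossMoment, Matrix.of_apply]
    rw [Complex.star_def, ← integral_conj]
    refine integral_congr_ae (Eventually.of_forall fun z => ?_)
    simp [mul_comm]
  · intro v
    -- The form at `v` becomes the trace against the rank-one matrix `v vᴴ`, so the integrand is a
    -- nonnegative quadratic form in `X z`.
    rw [← trace_mul_vecMulVec_star, Matrix.trace_mul_comm, trace_mul_crossMoment _ hX hX]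
    refine integral_nonneg fun z => ?_
    rw [trace_mul_vecMulVec_star]
    exact (Matrix.posSemidef_vecMulVec_self_star v).dotProduct_mulVec_nonneg _

/-- Young's inequality for the quadratic forms of a positive definite matrix and its inverse. -/
theorem two_mul_re_trace_vecMulVec_le {S : Matrix (Fin m) (Fin m) ℂ} (hS : S.PosDef)
    (v w : Fin m → ℂ) :
    2 * ((1 : Matrix (Fin m) (Fin m) ℂ) * Matrix.vecMulVec v (star w)).trace.re ≤
      (S * Matrix.vecMulVec v (star v)).trace.re + (S⁻¹ * Matrix.vecMulVec w (star w)).trace.re := by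
  simp only [trace_mul_vecMulVec_star]
  -- Completing the square: expanding this form gives the two quadratic terms minus twice the real
  -- part of the cross term.
  have h := hS.inv.posSemidef.dotProduct_mulVec_nonneg (S *ᵥ v - w)
  have hd : IsUnit S.det := (Matrix.isUnit_iff_isUnit_det S).1 hS.isUnit
  have e1 : S⁻¹ *ᵥ (S *ᵥ v) = v := by
    rw [Matrix.mulVec_mulVec, Matrix.nonsing_inv_mul _ hd, Matrix.one_mulVec]
  have e2 : star (S *ᵥ v) ⬝ᵥ (S⁻¹ *ᵥ w) = star v ⬝ᵥ w := by
    rw [Matrix.star_mulVec, hS.isHermitian.eq, ← Matrix.dotProduct_mulVec, Matrix.mulVec_mulVec,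
      Matrix.mul_nonsing_inv _ hd, Matrix.one_mulVec]
  have e3 : star (S *ᵥ v) ⬝ᵥ v = star v ⬝ᵥ S *ᵥ v := by
    rw [Matrix.star_mulVec, hS.isHermitian.eq, ← Matrix.dotProduct_mulVec]
  have e4 : (star v ⬝ᵥ w).re = (star w ⬝ᵥ v).re := by
    rw [← Complex.conj_re, ← Complex.star_def, Matrix.star_dotProduct, star_star, dotProduct_comm]
  rw [Matrix.mulVec_sub, e1, star_sub, sub_dotProduct, dotProduct_sub, dotProduct_sub, e2, e3] at h
  have h' := (Complex.le_def.1 h).1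
  simp only [Complex.zero_re, Complex.sub_re, e4] at h'
  rw [Matrix.one_mulVec]
  linarith

theorem re_trace_crossMoment_sub (hX : CoordMemLp γ X) (hY : CoordMemLp γ Y) :
    (crossMoment γ (fun z => X z - Y z) (fun z => X z - Y z)).trace.re =
      (crossMoment γ X X).trace.re + (crossMoment γ Y Y).trace.re -
        2 * (crossMoment γ X Y).trace.re := by
  have hr : ∀ {U V : Z → Fin m → ℂ}, CoordMemLp γ U → CoordMemLp γ V →
      (crossMoment γ U V).trace.re = ∫ z, (star (V z) ⬝ᵥ U z).re ∂γ := by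
    intro U V hU hV
    have := re_trace_mul_crossMoment 1 hU hV
    rw [one_mul] at this
    simpa only [trace_mul_vecMulVec_star, Matrix.one_mulVec] using this
  have hi : ∀ {U V : Z → Fin m → ℂ}, CoordMemLp γ U → CoordMemLp γ V →
      Integrable (fun z => (star (V z) ⬝ᵥ U z).re) γ := by
    intro U V hU hV
    have := integrable_re_trace_mul_vecMulVec 1 hU hV
    simpa only [trace_mul_vecMulVec_star, Matrix.one_mulVec] using this
  rw [hr (hX.sub hY) (hX.sub hY), hr hX hX, hr hY hY, hr hX hY, ← integral_const_mul,
    ← integral_add (hi hX hX) (hi hY hY), ← integral_sub ?_ ((hi hX hY).const_mul 2)]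
  swap
  · exact (hi hX hX).add (hi hY hY)
  refine integral_congr_ae (Eventually.of_forall fun z => ?_)
  have e4 : (star (X z) ⬝ᵥ Y z).re = (star (Y z) ⬝ᵥ X z).re := by
    rw [← Complex.conj_re, ← Complex.star_def, Matrix.star_dotProduct, star_star, dotProduct_comm]
  simp only [star_sub, sub_dotProduct, dotProduct_sub, Complex.sub_re, e4]
  ring

/-- Gelbrich's bound: the mean squared distance of two complex random vectors is at least the
squared Gelbrich distance of their second moment matrices. -/
theorem re_trace_gelbrich_crossMoment_le (hX : CoordMemLp γ X) (hY : CoordMemLp γ Y) :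
    (gelbrich (crossMoment γ X X) (crossMoment γ Y Y)).trace.re ≤
      (crossMoment γ (fun z => X z - Y z) (fun z => X z - Y z)).trace.re := by
  rw [re_trace_crossMoment_sub hX hY]
  refine re_trace_gelbrich_le (crossMoment_self_nonneg hX) (crossMoment_self_nonneg hY)
    fun S hS => ?_
  have h1 := re_trace_mul_crossMoment 1 hX hY
  rw [one_mul] at h1
  rw [h1, re_trace_mul_crossMoment S hX hX, re_trace_mul_crossMoment S⁻¹ hY hY,
    ← integral_const_mul, ← integral_add (integrable_re_trace_mul_vecMulVec S hX hX)
      (integrable_re_trace_mul_vecMulVec S⁻¹ hY hY)]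
  exact integral_mono ((integrable_re_trace_mul_vecMulVec 1 hX hY).const_mul 2)
    ((integrable_re_trace_mul_vecMulVec S hX hX).add
      (integrable_re_trace_mul_vecMulVec S⁻¹ hY hY))
    fun z => two_mul_re_trace_vecMulVec_le hS (X z) (Y z)

end Moments

/-! ### Fejér summation and orthogonality of cosines. -/

section Fejer

/-- The right side is the border (last column and last row) added when an `n × n` square of lags
grows to side `n + 1`; this is the induction step of `sum_sum_lag_eq`. -/
theorem sum_Icc_neg_eq {M : Type*} [AddCommGroup M] (f : ℤ → M) (n : ℕ) :
    ∑ k ∈ Finset.Icc (-(n : ℤ)) n, f k =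
      ∑ i ∈ Finset.range n, f (n - i) + ∑ j ∈ Finset.range (n + 1), f (j - n) := by
  have h1 : ∀ n : ℕ, ∑ i ∈ Finset.range n, f (n - i) = ∑ i ∈ Finset.range n, f (i + 1) := by
    intro n
    rw [← Finset.sum_range_reflect]
    refine Finset.sum_congr rfl fun i hi => congrArg f ?_
    have := Finset.mem_range.1 hi
    omega
  have h2 : ∀ n : ℕ, ∑ j ∈ Finset.range (n + 1), f (j - n) =
      ∑ j ∈ Finset.range (n + 1), f (-j) := by
    intro n
    rw [← Finset.sum_range_reflect]
    refine Finset.sum_congr rfl fun i hi => congrArg f ?_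
    have := Finset.mem_range.1 hi
    omega
  rw [h1, h2]
  induction n with
  | zero => simp
  | succ n ih =>
    rw [Finset.sum_range_succ, Finset.sum_range_succ (n := n + 1)]
    push_cast
    rw [Finset.sum_Icc_succ_eq_add_endpoints, ih]
    abel

/-- Summing a function of the lag over a square gives the sum of its symmetric partial sums. -/
theorem sum_sum_lag_eq {M : Type*} [AddCommGroup M] (f : ℤ → M) (n : ℕ) :
    ∑ i ∈ Finset.range n, ∑ j ∈ Finset.range n, f (j - i) =
      ∑ N ∈ Finset.range n, ∑ k ∈ Finset.Icc (-(N : ℤ)) N, f k := by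
  induction n with
  | zero => simp
  | succ n ih =>
    rw [Finset.sum_range_succ,
      Finset.sum_range_succ (fun N : ℕ => ∑ k ∈ Finset.Icc (-(N : ℤ)) N, f k), ← ih, sum_Icc_neg_eq]
    simp only [Finset.sum_range_succ (n := n), Finset.sum_add_distrib]
    abel

theorem integral_cos_int_mul (k : ℤ) :
    ∫ ω in (0 : ℝ)..(2 * Real.pi), Real.cos (k * ω) = if k = 0 then 2 * Real.pi else 0 := by
  split_ifs with h
  · simp [h]
  · have hk : (k : ℝ) ≠ 0 := by exact_mod_cast h
    rw [intervalIntegral.integral_comp_mul_left (fun x => Real.cos x) hk, integral_cos]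
    have : Real.sin (k * (2 * Real.pi)) = 0 := by
      have := Real.sin_int_mul_pi (k * 2)
      push_cast at this
      rwa [mul_assoc] at this
    simp [this]

end Fejer

/-! ### Finite Fourier transforms, Fejér means of the spectrum, Parseval. -/

section Fourier

/-- A real vector, seen as a complex one. -/
noncomputable def complexify {m : ℕ} (u : E m) : Fin m → ℂ := fun a => (u a : ℂ)

/-- The normalized finite Fourier transform `n^{-1/2} ∑_{j < n} e^{iωj} u_j` of a process. -/
noncomputable def fourierSum {m : ℕ} {Z : Type*} (n : ℕ) (ω : ℝ) (u : ℤ → Z → E m) (z : Z) :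
    Fin m → ℂ :=
  ∑ j ∈ Finset.range n,
    ((((Real.sqrt n)⁻¹ : ℝ) : ℂ) * Complex.exp (Complex.I * ω * j)) • complexify (u j z)

theorem fourierSum_sub {m : ℕ} {Z : Type*} (u v : ℤ → Z → E m) (n : ℕ) (ω : ℝ) :
    (fun z => fourierSum n ω u z - fourierSum n ω v z) =
      fourierSum n ω (fun k z => u k z - v k z) := by
  funext z
  simp only [fourierSum, ← Finset.sum_sub_distrib, ← smul_sub]
  refine Finset.sum_congr rfl fun j _ => ?_
  congr 1
  funext a
  simp [complexify]

variable {m : ℕ} {Z : Type*} [MeasurableSpace Z] {γ : Measure Z}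

/-- The Fejér mean of the power spectrum of a process. -/
noncomputable def fejerMean (γ : Measure Z) (u : ℤ → Z → E m) (n : ℕ) (ω : ℝ) :
    Matrix (Fin m) (Fin m) ℂ :=
  (n⁻¹ : ℝ) • ∑ N ∈ Finset.range n, ∑ k ∈ Finset.Icc (-(N : ℤ)) (N : ℤ),
    Complex.exp (-(Complex.I * (ω : ℂ) * (k : ℂ))) • (autocorr γ u 0 k).map Complex.ofReal

theorem memLp_coord {u : Z → E m} (hu : MemLp u 2 γ) (a : Fin m) : MemLp (fun z => u z a) 2 γ :=
  (EuclideanSpace.proj (𝕜 := ℝ) a).comp_memLp' hu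

theorem coordMemLp_complexify {u : Z → E m} (hu : MemLp u 2 γ) :
    CoordMemLp γ (fun z => complexify (u z)) :=
  fun a => (memLp_coord hu a).ofReal

theorem coordMemLp_fourierSum {u : ℤ → Z → E m} (hu : ∀ k, MemLp (u k) 2 γ) (n : ℕ) (ω : ℝ) :
    CoordMemLp γ (fourierSum n ω u) :=
  CoordMemLp.sum_smul (Finset.range n) _ (U := fun (j : ℕ) z => complexify (u j z))
    fun j => coordMemLp_complexify (hu j)

theorem crossMoment_complexify (u : ℤ → Z → E m) (i j : ℤ) :
    crossMoment γ (fun z => complexify (u i z)) (fun z => complexify (u j z)) =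
      (autocorr γ u i (j - i)).map Complex.ofReal := by
  ext a b
  simp only [crossMoment, complexify, Matrix.of_apply, autocorr, Matrix.map_apply,
    add_sub_cancel, Complex.star_def, Complex.conj_ofReal, ← Complex.ofReal_mul]
  exact integral_ofReal

/-- Stationarity is not assumed, because the formula is also applied to the difference of the
coupled processes, which need not be stationary. -/
theorem crossMoment_fourierSum {u : ℤ → Z → E m} (hu : ∀ k, MemLp (u k) 2 γ) (n : ℕ) (ω : ℝ) :
    crossMoment γ (fourierSum n ω u) (fourierSum n ω u) =
      (n⁻¹ : ℝ) • ∑ i ∈ Finset.range n, ∑ j ∈ Finset.range n,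
        Complex.exp (-(Complex.I * (ω : ℂ) * (((j : ℤ) - i : ℤ) : ℂ))) •
          (autocorr γ u i (j - i)).map Complex.ofReal := by
  have h := crossMoment_sum_smul (γ := γ) (Finset.range n)
    (fun j : ℕ => (((Real.sqrt n)⁻¹ : ℝ) : ℂ) * Complex.exp (Complex.I * ω * j))
    (U := fun (j : ℕ) z => complexify (u j z)) fun j => coordMemLp_complexify (hu j)
  refine h.trans ?_
  simp only [Finset.smul_sum, crossMoment_complexify]
  refine Finset.sum_congr rfl fun i _ => Finset.sum_congr rfl fun j _ => ?_
  rw [← Complex.coe_smul, smul_smul]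
  congr 1
  -- Also true for `n = 0`, where both sides vanish by the convention `0⁻¹ = 0`.
  have hn : ((((Real.sqrt n)⁻¹ : ℝ) : ℂ)) * (((Real.sqrt n)⁻¹ : ℝ) : ℂ) = ((n⁻¹ : ℝ) : ℂ) := by
    rw [← Complex.ofReal_mul, ← mul_inv, Real.mul_self_sqrt (Nat.cast_nonneg n)]
  have he : star (Complex.exp (Complex.I * ω * j)) = Complex.exp (-(Complex.I * ω * j)) := by
    rw [Complex.star_def, ← Complex.exp_conj]
    simp
  -- The phases `e^{iωi}` and `e^{-iωj}` combine to `e^{-iω(j-i)}`; the positive sign in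
  -- `fourierSum` is what matches the convention `R(k) = 𝔼[x_i x_{i+k}ᵀ]`.
  rw [star_mul', he, Complex.star_def, Complex.conj_ofReal, mul_mul_mul_comm, hn, ← Complex.exp_add]
  congr 2
  push_cast
  ring

theorem crossMoment_fourierSum_eq_fejerMean {u : ℤ → Z → E m} (hu : IsStationary γ u) (n : ℕ)
    (ω : ℝ) : crossMoment γ (fourierSum n ω u) (fourierSum n ω u) = fejerMean γ u n ω := by
  rw [crossMoment_fourierSum hu.memLp_two, fejerMean, ← sum_sum_lag_eq]
  simp only [hu.autocorr_eq _ 0]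

theorem fejerMean_nonneg {u : ℤ → Z → E m} (hu : IsStationary γ u) (n : ℕ) (ω : ℝ) :
    0 ≤ fejerMean γ u n ω := by
  rw [← crossMoment_fourierSum_eq_fejerMean hu]
  exact crossMoment_self_nonneg (coordMemLp_fourierSum hu.memLp_two n ω)

-- Cesàro means of a convergent sequence keep its limit.
open scoped Matrix.Norms.L2Operator in
theorem tendsto_fejerMean {u : ℤ → Z → E m} {Φ : ℝ → Matrix (Fin m) (Fin m) ℂ}
    (hΦ : IsPowerSpectrum γ u Φ) (ω : ℝ) :
    Tendsto (fun n => fejerMean γ u n ω) atTop (𝓝 (Φ ω)) :=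
  (hΦ ω).cesaro_smul

theorem continuous_fejerMean (u : ℤ → Z → E m) (n : ℕ) : Continuous (fejerMean γ u n) := by
  unfold fejerMean
  fun_prop

/-- The power spectrum of a stationary process is positive semidefinite. -/
theorem IsPowerSpectrum.nonneg {u : ℤ → Z → E m} {Φ : ℝ → Matrix (Fin m) (Fin m) ℂ}
    (hu : IsStationary γ u) (hΦ : IsPowerSpectrum γ u Φ) (ω : ℝ) : 0 ≤ Φ ω := by
  have hc : IsClosed {A : Matrix (Fin m) (Fin m) ℂ | 0 ≤ A} := by
    have : {A : Matrix (Fin m) (Fin m) ℂ | 0 ≤ A} =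
        {A | Aᴴ = A} ∩ ⋂ v : Fin m → ℂ, {A | 0 ≤ star v ⬝ᵥ A *ᵥ v} := by
      ext A
      simp only [Set.mem_ofPred_eq, Matrix.nonneg_iff_posSemidef,
        Matrix.posSemidef_iff_dotProduct_mulVec, Set.mem_inter_iff, Set.mem_iInter,
        Matrix.IsHermitian]
    rw [this]
    refine (isClosed_eq (by fun_prop) continuous_id).inter (isClosed_iInter fun v => ?_)
    exact isClosed_le continuous_const (by fun_prop)
  exact hc.mem_of_tendsto (tendsto_fejerMean hΦ ω)
    (Eventually.of_forall fun n => fejerMean_nonneg hu n ω)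

theorem re_trace_crossMoment_fourierSum {u : ℤ → Z → E m} (hu : ∀ k, MemLp (u k) 2 γ) (n : ℕ)
    (ω : ℝ) :
    (crossMoment γ (fourierSum n ω u) (fourierSum n ω u)).trace.re =
      (n⁻¹ : ℝ) * ∑ i ∈ Finset.range n, ∑ j ∈ Finset.range n,
        Real.cos (((j : ℤ) - i : ℤ) * ω) * (autocorr γ u i (j - i)).trace := by
  rw [crossMoment_fourierSum hu]
  have ht : ∀ A : Matrix (Fin m) (Fin m) ℝ, (A.map Complex.ofReal).trace = (A.trace : ℂ) := by
    intro A
    simp [Matrix.trace]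
  have he : ∀ k : ℤ, (Complex.exp (-(Complex.I * (ω : ℂ) * (k : ℂ)))).re = Real.cos (k * ω) := by
    intro k
    have : -(Complex.I * (ω : ℂ) * (k : ℂ)) = ((-(k * ω) : ℝ) : ℂ) * Complex.I := by
      push_cast; ring
    rw [this, Complex.exp_ofReal_mul_I_re, Real.cos_neg]
  simp only [Matrix.trace_smul, Matrix.trace_sum, ht, Complex.smul_re, Complex.re_sum, smul_eq_mul,
    Complex.re_mul_ofReal, he]

/-- Parseval's identity for the finite Fourier transform. -/
theorem integral_re_trace_crossMoment_fourierSum {u : ℤ → Z → E m} (hu : ∀ k, MemLp (u k) 2 γ)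
    (n : ℕ) :
    ∫ ω in (0 : ℝ)..(2 * Real.pi), (crossMoment γ (fourierSum n ω u) (fourierSum n ω u)).trace.re =
      2 * Real.pi * ((n⁻¹ : ℝ) * ∑ i ∈ Finset.range n, (autocorr γ u i 0).trace) := by
  simp only [re_trace_crossMoment_fourierSum hu]
  rw [intervalIntegral.integral_const_mul, intervalIntegral.integral_finsetSum]
  swap
  · intro i _
    exact Continuous.intervalIntegrable (by fun_prop) _ _
  have : ∀ i ∈ Finset.range n, ∫ ω in (0 : ℝ)..(2 * Real.pi), ∑ j ∈ Finset.range n,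
      Real.cos (((j : ℤ) - i : ℤ) * ω) * (autocorr γ u i (j - i)).trace =
      2 * Real.pi * (autocorr γ u i 0).trace := by
    intro i hi
    rw [intervalIntegral.integral_finsetSum]
    swap
    · intro j _
      exact Continuous.intervalIntegrable (by fun_prop) _ _
    simp only [intervalIntegral.integral_mul_const, integral_cos_int_mul]
    -- Integration over a full period kills every nonzero lag.
    rw [Finset.sum_eq_single i]
    · simp
    · intro j _ hj
      have : ((j : ℤ) - i) ≠ 0 := by omega
      simp [this]
    · exact fun h => (h hi).elim
  rw [Finset.sum_congr rfl this, ← Finset.mul_sum]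
  ring

theorem trace_autocorr_zero {u : ℤ → Z → E m} (hu : ∀ k, MemLp (u k) 2 γ) (i : ℤ) :
    (autocorr γ u i 0).trace = ∫ z, ‖u i z‖ ^ 2 ∂γ := by
  simp only [Matrix.trace, Matrix.diag, autocorr, Matrix.of_apply, add_zero,
    EuclideanSpace.norm_sq_eq, Real.norm_eq_abs, sq_abs]
  rw [integral_finsetSum _ fun a _ => (memLp_coord (hu i) a).integrable_sq]
  simp only [sq]

end Fourier

/-! ### Transfer of second-order structure from a process to a coupling. -/

section Transfer

variable {m : ℕ} {Ω Z : Type*} [MeasurableSpace Ω] [MeasurableSpace Z] {P : Measure Ω}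
  {γ : Measure Z} {x : ℤ → Ω → E m} {f : Z → ℤ → E m}

/-- Both sides are the same integral against the law on sequence space. Used with the two
projections of a coupling as `f`. -/
theorem autocorr_eq_of_map_eq_law (hx_meas : ∀ k, Measurable (x k)) (hf : Measurable f)
    (hfx : γ.map f = law P x) (i k : ℤ) :
    autocorr γ (fun k z => f z k) i k = autocorr P x i k := by
  ext a b
  have hg : Measurable fun s : ℤ → E m => s i a * s (i + k) b := by fun_prop
  have h1 := integral_map (μ := γ) hf.aemeasurable hg.aestronglyMeasurable
  have h2 := integral_map (μ := P) (φ := fun s k => x k s) (by fun_prop) hg.aestronglyMeasurable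
  rw [hfx] at h1
  exact h1.symm.trans h2

theorem IsStationary.of_map_eq_law (hx : IsStationary P x) (hx_meas : ∀ k, Measurable (x k))
    (hf : Measurable f) (hfx : γ.map f = law P x) : IsStationary γ (fun k z => f z k) where
  memLp_two k := by
    have hg : Measurable fun s : ℤ → E m => s k := by fun_prop
    have h2 := (memLp_map_measure_iff (μ := P) (f := fun s k => x k s) (p := 2)
      hg.aestronglyMeasurable (by fun_prop)).2 (hx.memLp_two k)
    have h3 : MemLp (fun s : ℤ → E m => s k) 2 (γ.map f) := hfx ▸ h2
    exact (memLp_map_measure_iff hg.aestronglyMeasurable hf.aemeasurable).1 h3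
  autocorr_eq i j k := by
    simp only [autocorr_eq_of_map_eq_law hx_meas hf hfx]
    exact hx.autocorr_eq i j k

theorem IsPowerSpectrum.of_map_eq_law {Φ : ℝ → Matrix (Fin m) (Fin m) ℂ}
    (hΦ : IsPowerSpectrum P x Φ) (hx_meas : ∀ k, Measurable (x k))
    (hf : Measurable f) (hfx : γ.map f = law P x) : IsPowerSpectrum γ (fun k z => f z k) Φ := by
  intro ω
  simp only [autocorr_eq_of_map_eq_law hx_meas hf hfx]
  exact hΦ ω

end Transfer

/-! ### The spectral lower bound for a fixed coupling. -/

section LowerBound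

variable {m : ℕ} {Z : Type*} [MeasurableSpace Z] {γ : Measure Z} {u v : ℤ → Z → E m}
  {Φu Φv : ℝ → Matrix (Fin m) (Fin m) ℂ}

theorem continuous_re_trace_gelbrich_fejerMean (hu : IsStationary γ u) (hv : IsStationary γ v)
    (n : ℕ) :
    Continuous fun ω => (gelbrich (fejerMean γ u n ω) (fejerMean γ v n ω)).trace.re :=
  continuous_iff_continuousAt.2 fun ω =>
    tendsto_re_trace_gelbrich (fejerMean_nonneg hu n) (fejerMean_nonneg hv n)
      (fejerMean_nonneg hu n ω) (fejerMean_nonneg hv n ω)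
      ((continuous_fejerMean u n).tendsto ω) ((continuous_fejerMean v n).tendsto ω)

theorem tendsto_re_trace_gelbrich_fejerMean (hu : IsStationary γ u) (hv : IsStationary γ v)
    (hΦu : IsPowerSpectrum γ u Φu) (hΦv : IsPowerSpectrum γ v Φv) (ω : ℝ) :
    Tendsto (fun n => (gelbrich (fejerMean γ u n ω) (fejerMean γ v n ω)).trace.re) atTop
      (𝓝 (gelbrich (Φu ω) (Φv ω)).trace.re) :=
  tendsto_re_trace_gelbrich (fun n => fejerMean_nonneg hu n ω) (fun n => fejerMean_nonneg hv n ω)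
    (hΦu.nonneg hu ω) (hΦv.nonneg hv ω) (tendsto_fejerMean hΦu ω) (tendsto_fejerMean hΦv ω)

/-- The spectra are mere pointwise limits; measurability comes from the continuity of the Fejér
approximants. -/
theorem measurable_re_trace_gelbrich (hu : IsStationary γ u) (hv : IsStationary γ v)
    (hΦu : IsPowerSpectrum γ u Φu) (hΦv : IsPowerSpectrum γ v Φv) :
    Measurable fun ω => (gelbrich (Φu ω) (Φv ω)).trace.re :=
  measurable_of_tendsto_metrizable
    (fun n => (continuous_re_trace_gelbrich_fejerMean hu hv n).measurable)
    (tendsto_pi_nhds.2 (tendsto_re_trace_gelbrich_fejerMean hu hv hΦu hΦv))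

/-- The integrated Gelbrich distance of the Fejér means is a lower bound for the time average of
the mean squared distance. -/
theorem lintegral_gelbrich_fejerMean_le (hu : IsStationary γ u) (hv : IsStationary γ v) (n : ℕ) :
    ∫⁻ ω in Set.Ioc 0 (2 * Real.pi),
        ENNReal.ofReal (gelbrich (fejerMean γ u n ω) (fejerMean γ v n ω)).trace.re ≤
      ENNReal.ofReal (2 * Real.pi *
        ((n⁻¹ : ℝ) * ∑ i ∈ Finset.range n, ∫ z, ‖u i z - v i z‖ ^ 2 ∂γ)) := by
  have hd : ∀ k, MemLp (fun z => u k z - v k z) 2 γ :=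
    fun k => (hu.memLp_two k).sub (hv.memLp_two k)
  set g : ℝ → ℝ := fun ω => (crossMoment γ (fourierSum n ω fun k z => u k z - v k z)
    (fourierSum n ω fun k z => u k z - v k z)).trace.re with hg
  have hle : ∀ ω, (gelbrich (fejerMean γ u n ω) (fejerMean γ v n ω)).trace.re ≤ g ω := by
    intro ω
    rw [← crossMoment_fourierSum_eq_fejerMean hu, ← crossMoment_fourierSum_eq_fejerMean hv, hg]
    simp only [← fourierSum_sub]
    exact re_trace_gelbrich_crossMoment_le (coordMemLp_fourierSum hu.memLp_two n ω)
      (coordMemLp_fourierSum hv.memLp_two n ω)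
  have hg0 : ∀ ω, 0 ≤ g ω := fun ω =>
    (re_trace_gelbrich_nonneg (fejerMean_nonneg hu n ω) (fejerMean_nonneg hv n ω)).trans (hle ω)
  have hgc : Continuous g := by
    simp only [hg, re_trace_crossMoment_fourierSum hd]
    fun_prop
  have hpi : (0 : ℝ) ≤ 2 * Real.pi := by positivity
  have hint := integral_re_trace_crossMoment_fourierSum hd n
  simp only [trace_autocorr_zero hd] at hint
  rw [← hint, intervalIntegral.integral_of_le hpi, ofReal_integral_eq_lintegral_ofReal
    (hgc.integrableOn_Ioc) (Eventually.of_forall hg0)]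
  exact lintegral_mono fun ω => ENNReal.ofReal_le_ofReal (hle ω)

/-- Fatou's lemma along the Fejér means. The index is shifted to `n + 1` to match the average over
times `0, …, n` in the definition of the distance. -/
theorem lintegral_gelbrich_le_liminf (hu : IsStationary γ u) (hv : IsStationary γ v)
    (hΦu : IsPowerSpectrum γ u Φu) (hΦv : IsPowerSpectrum γ v Φv) :
    ∫⁻ ω in Set.Ioc 0 (2 * Real.pi), ENNReal.ofReal (gelbrich (Φu ω) (Φv ω)).trace.re ≤
      liminf (fun n : ℕ => ENNReal.ofReal (2 * Real.pi * ((((n + 1 : ℕ) : ℝ)⁻¹ : ℝ) *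
        ∑ i ∈ Finset.range (n + 1), ∫ z, ‖u i z - v i z‖ ^ 2 ∂γ))) atTop := by
  have hlim : ∀ ω, ENNReal.ofReal (gelbrich (Φu ω) (Φv ω)).trace.re =
      liminf (fun n : ℕ => ENNReal.ofReal
        (gelbrich (fejerMean γ u (n + 1) ω) (fejerMean γ v (n + 1) ω)).trace.re) atTop := fun ω =>
    (ENNReal.tendsto_ofReal ((tendsto_re_trace_gelbrich_fejerMean hu hv hΦu hΦv ω).comp
      (tendsto_add_atTop_nat 1))).liminf_eq.symm
  simp only [hlim]
  refine (lintegral_liminf_le fun n =>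
    (continuous_re_trace_gelbrich_fejerMean hu hv (n + 1)).measurable.ennreal_ofReal).trans ?_
  exact liminf_le_liminf (Eventually.of_forall fun n =>
    lintegral_gelbrich_fejerMean_le hu hv (n + 1))

/-- From `‖u - v‖² ≤ 2‖u‖² + 2‖v‖²`; stationarity makes the bound independent of `i`, so the time
averages stay bounded. -/
theorem integral_norm_sub_sq_le (hu : IsStationary γ u) (hv : IsStationary γ v) (i : ℤ) :
    ∫ z, ‖u i z - v i z‖ ^ 2 ∂γ ≤
      2 * (autocorr γ u 0 0).trace + 2 * (autocorr γ v 0 0).trace := by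
  have hiu := (hu.memLp_two i).norm.integrable_sq
  have hiv := (hv.memLp_two i).norm.integrable_sq
  rw [← hu.autocorr_eq i 0 0, ← hv.autocorr_eq i 0 0, trace_autocorr_zero hu.memLp_two,
    trace_autocorr_zero hv.memLp_two, ← integral_const_mul, ← integral_const_mul,
    ← integral_add (hiu.const_mul 2) (hiv.const_mul 2)]
  refine integral_mono ((hu.memLp_two i).sub (hv.memLp_two i)).norm.integrable_sq
    ((hiu.const_mul 2).add (hiv.const_mul 2)) fun z => ?_
  have h1 := norm_sub_le (u i z) (v i z)
  have h2 := norm_nonneg (u i z - v i z)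
  nlinarith [sq_nonneg (‖u i z‖ - ‖v i z‖)]

theorem lintegral_gelbrich_lt_top (hu : IsStationary γ u) (hv : IsStationary γ v)
    (hΦu : IsPowerSpectrum γ u Φu) (hΦv : IsPowerSpectrum γ v Φv) :
    ∫⁻ ω in Set.Ioc 0 (2 * Real.pi), ENNReal.ofReal (gelbrich (Φu ω) (Φv ω)).trace.re < ∞ := by
  set K := 2 * (autocorr γ u 0 0).trace + 2 * (autocorr γ v 0 0).trace
  refine (lintegral_gelbrich_le_liminf hu hv hΦu hΦv).trans_lt
    (lt_of_le_of_lt ?_ (ENNReal.ofReal_lt_top (r := 2 * Real.pi * K)))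
  refine (liminf_le_limsup (by isBoundedDefault) (by isBoundedDefault)).trans
    (limsup_le_of_le (by isBoundedDefault) (Eventually.of_forall fun n =>
      ENNReal.ofReal_le_ofReal (mul_le_mul_of_nonneg_left ?_ (by positivity))))
  rw [inv_mul_le_iff₀ (by positivity)]
  refine (Finset.sum_le_sum fun (i : ℕ) _ => integral_norm_sub_sq_le hu hv i).trans_eq ?_
  simp [K, mul_add]

theorem intervalIntegrable_gelbrich (hu : IsStationary γ u) (hv : IsStationary γ v)
    (hΦu : IsPowerSpectrum γ u Φu) (hΦv : IsPowerSpectrum γ v Φv) :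
    IntervalIntegrable (fun ω => (gelbrich (Φu ω) (Φv ω)).trace.re) volume 0 (2 * Real.pi) := by
  rw [intervalIntegrable_iff_integrableOn_Ioc_of_le (by positivity)]
  refine ⟨(measurable_re_trace_gelbrich hu hv hΦu hΦv).aestronglyMeasurable, ?_⟩
  rw [hasFiniteIntegral_iff_ofReal (Eventually.of_forall fun ω =>
    re_trace_gelbrich_nonneg (hΦu.nonneg hu ω) (hΦv.nonneg hv ω))]
  exact lintegral_gelbrich_lt_top hu hv hΦu hΦv

theorem lintegral_enorm_stack_sub (hu : IsStationary γ u) (hv : IsStationary γ v) (i : ℕ) :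
    ∫⁻ z, ‖stack (fun k => u k z) i - stack (fun k => v k z) i‖ₑ ^ (2 : ℝ) ∂γ =
      ENNReal.ofReal (∑ k ∈ Finset.range (i + 1), ∫ z, ‖u k z - v k z‖ ^ 2 ∂γ) := by
  have hi : ∀ k : ℤ, Integrable (fun z => ‖u k z - v k z‖ ^ 2) γ :=
    fun k => ((hu.memLp_two k).sub (hv.memLp_two k)).norm.integrable_sq
  rw [← integral_finsetSum _ fun (k : ℕ) _ => hi k, ofReal_integral_eq_lintegral_ofReal
    (integrable_finsetSum _ fun (k : ℕ) _ => hi k)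
    (Eventually.of_forall fun z => Finset.sum_nonneg fun k _ => sq_nonneg _)]
  refine lintegral_congr fun z => ?_
  rw [← ofReal_norm, ENNReal.ofReal_rpow_of_nonneg (norm_nonneg _) zero_le_two,
    Real.rpow_two, PiLp.norm_sq_eq_of_L2, Finset.sum_range]
  rfl

/-- The spectral lower bound for the average cost of a fixed coupling. -/
theorem ofReal_integral_gelbrich_le_limsup (hu : IsStationary γ u) (hv : IsStationary γ v)
    (hΦu : IsPowerSpectrum γ u Φu) (hΦv : IsPowerSpectrum γ v Φv) :
    ENNReal.ofReal ((1 / (2 * Real.pi)) *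
        ∫ ω in (0 : ℝ)..(2 * Real.pi), (gelbrich (Φu ω) (Φv ω)).trace.re) ≤
      limsup (fun i : ℕ =>
        (∫⁻ z, ‖stack (fun k => u k z) i - stack (fun k => v k z) i‖ₑ ^ (2 : ℝ) ∂γ) /
          ((i : ℝ≥0∞) + 1)) atTop := by
  have hpi : (0 : ℝ) < 2 * Real.pi := by positivity
  have hI := (intervalIntegrable_iff_integrableOn_Ioc_of_le hpi.le).1
    (intervalIntegrable_gelbrich hu hv hΦu hΦv)
  have hterm : ∀ i : ℕ,
      (∫⁻ z, ‖stack (fun k => u k z) i - stack (fun k => v k z) i‖ₑ ^ (2 : ℝ) ∂γ) /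
          ((i : ℝ≥0∞) + 1) =
        ENNReal.ofReal (1 / (2 * Real.pi)) * ENNReal.ofReal (2 * Real.pi *
          ((((i + 1 : ℕ) : ℝ)⁻¹ : ℝ) *
            ∑ k ∈ Finset.range (i + 1), ∫ z, ‖u k z - v k z‖ ^ 2 ∂γ)) := by
    intro i
    have hi : ((i : ℝ≥0∞) + 1) = ENNReal.ofReal ((i + 1 : ℕ) : ℝ) := by
      rw [ENNReal.ofReal_natCast]; push_cast; rfl
    rw [lintegral_enorm_stack_sub hu hv, hi, ← ENNReal.ofReal_div_of_pos (by positivity),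
      ← ENNReal.ofReal_mul (by positivity)]
    congr 1
    field_simp
  simp only [hterm]
  rw [ENNReal.limsup_const_mul_of_ne_top ENNReal.ofReal_ne_top,
    ENNReal.ofReal_mul (by positivity), intervalIntegral.integral_of_le hpi.le,
    ofReal_integral_eq_lintegral_ofReal hI (Eventually.of_forall fun ω =>
      re_trace_gelbrich_nonneg (hΦu.nonneg hu ω) (hΦv.nonneg hv ω))]
  gcongr
  exact (lintegral_gelbrich_le_liminf hu hv hΦu hΦv).trans liminf_le_limsup

end LowerBound

end SpectralW2

theorem corollary1 {m : ℕ} {Ω Ω' : Type*} [MeasurableSpace Ω] [MeasurableSpace Ω']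
    (P : Measure Ω) [IsProbabilityMeasure P] (P' : Measure Ω') [IsProbabilityMeasure P']
    (x : ℤ → Ω → SpectralW2.E m) (y : ℤ → Ω' → SpectralW2.E m)
    (hx_meas : ∀ k, Measurable (x k)) (hy_meas : ∀ k, Measurable (y k))
    (hx : SpectralW2.IsStationary P x) (hy : SpectralW2.IsStationary P' y)
    (Φx Φy : ℝ → Matrix (Fin m) (Fin m) ℂ)
    (hΦx : SpectralW2.IsPowerSpectrum P x Φx) (hΦy : SpectralW2.IsPowerSpectrum P' y Φy) :
    IntervalIntegrable (fun ω => (SpectralW2.gelbrich (Φx ω) (Φy ω)).trace.re)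
        volume 0 (2 * Real.pi) ∧
      ENNReal.ofReal (Real.sqrt ((1 / (2 * Real.pi)) *
          ∫ ω in (0 : ℝ)..(2 * Real.pi), (SpectralW2.gelbrich (Φx ω) (Φy ω)).trace.re)) ≤
        SpectralW2.avgWasserstein 2 (SpectralW2.law P x) (SpectralW2.law P' y) := by
  have hcoupled : ∀ γ ∈ SpectralW2.couplings (SpectralW2.law P x) (SpectralW2.law P' y),
      (SpectralW2.IsStationary γ (fun k z => z.1 k) ∧
        SpectralW2.IsStationary γ (fun k z => z.2 k)) ∧
      SpectralW2.IsPowerSpectrum γ (fun k z => z.1 k) Φx ∧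
        SpectralW2.IsPowerSpectrum γ (fun k z => z.2 k) Φy :=
    fun γ hγ => ⟨⟨hx.of_map_eq_law hx_meas measurable_fst hγ.1,
      hy.of_map_eq_law hy_meas measurable_snd hγ.2⟩,
      hΦx.of_map_eq_law hx_meas measurable_fst hγ.1, hΦy.of_map_eq_law hy_meas measurable_snd hγ.2⟩
  constructor
  -- Integrability involves only the spectra, but its proof needs some coupling; the product law
  -- provides one.
  · have : IsProbabilityMeasure (SpectralW2.law P x) :=
      Measure.isProbabilityMeasure_map (by fun_prop)
    have : IsProbabilityMeasure (SpectralW2.law P' y) :=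
      Measure.isProbabilityMeasure_map (by fun_prop)
    obtain ⟨⟨h1, h2⟩, h3, h4⟩ := hcoupled ((SpectralW2.law P x).prod (SpectralW2.law P' y))
      ⟨by simp [Measure.map_fst_prod], by simp [Measure.map_snd_prod]⟩
    exact SpectralW2.intervalIntegrable_gelbrich h1 h2 h3 h4
  · rw [SpectralW2.avgWasserstein]
    -- A negative value would make the real square root zero and the bound trivial, so the sign of
    -- the integral need not be established here.
    rcases le_or_gt 0 ((1 / (2 * Real.pi)) * ∫ ω in (0 : ℝ)..(2 * Real.pi),
      (SpectralW2.gelbrich (Φx ω) (Φy ω)).trace.re) with h | h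
    · rw [Real.sqrt_eq_rpow, ← ENNReal.ofReal_rpow_of_nonneg h (by norm_num)]
      refine ENNReal.rpow_le_rpow (le_iInf₂ fun γ hγ => ?_) (by norm_num)
      obtain ⟨⟨h1, h2⟩, h3, h4⟩ := hcoupled γ hγ
      exact SpectralW2.ofReal_integral_gelbrich_le_limsup h1 h2 h3 h4
    · rw [Real.sqrt_eq_zero_of_nonpos h.le, ENNReal.ofReal_zero]
      exact zero_le
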